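/- Let $p\ge 1$ and let $q\in(1,\infty]$ be its Hölder conjugate, $\frac1p+\frac1q=1$ (when $p=1$, $q=\infty$ and $\frac1q=0$, and $0^0=1$). Let $s,\mu,\omega>0$. For a nonnegative function $f$ on $\mathbb{R}^n$, let $\operatorname{supp} f$ denote the closure of $\{x\in\mathbb{R}^n : f(x)>0\}$. Let $f,g,h:\mathbb{R}^n\to[0,\infty)$ be Lebesgue integrable functions with nonempty supports such that, for all $x\in\operatorname{supp} f$, $y\in\operatorname{supp} g$ and $\lambda\in[0,1]$, $$h\bigl((1-\lambda)^{1/q}\mu^{1/p}x+\lambda^{1/q}\omega^{1/p}y\bigr)^{1/s}\ \ge\ (1-\lambda)^{1/q}\mu^{1/p}f(x)^{1/s}+\lambda^{1/q}\omega^{1/p}g(y)^{1/s}.$$ Then $$\Bigl(\int_{\mathbb{R}^n} h\Bigr)^{\frac{p}{n+s}}\ \ge\ \mu\Bigl(\int_{\mathbb{R}^n} f\Bigr)^{\frac{p}{n+s}}+\omega\Bigl(\int_{\mathbb{R}^n} g\Bigr)^{\frac{p}{n+s}}.$$ -/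

import Mathlib

open MeasureTheory
open scoped ENNReal

open Set Filter Topology

/-! For fixed λ in (0,1) the hypothesis is a Borell–Brascamp–Lieb condition with weights α =
(1-λ)^{1/q} μ^{1/p} and β = λ^{1/q} ω^{1/p}. Rescaling absorbs the weights, so
`integral_rpow_add_le` bounds α(∫f)^{1/(n+s)} + β(∫g)^{1/(n+s)} by (∫h)^{1/(n+s)}. Choosing λ as in
the equality case of Hölder turns this into the p-th power sum
(`rpow_add_rpow_le_of_forall_mem_Ioo`).

The unweighted inequality goes by induction on dimension. In dimension one, functions normalised to
supremum 1 are compared level set by level set, and Hölder undoes the normalisation. -/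

/-! ### Dimension one -/

/-- One-dimensional Brunn–Minkowski inequality. -/
lemma Real.volume_add_volume_le_of_add_mem {A B C : Set ℝ} (hA : MeasurableSet A)
    (hB : MeasurableSet B) (hA' : A.Nonempty) (hB' : B.Nonempty)
    (hC : ∀ a ∈ A, ∀ b ∈ B, a + b ∈ C) : volume A + volume B ≤ volume C := by
  have key : ∀ K ⊆ A, IsCompact K → K.Nonempty → ∀ L ⊆ B, IsCompact L → L.Nonempty →
      volume K + volume L ≤ volume C := by
    intro K hKA hK hK' L hLB hL hL'
    obtain ⟨k, hk, hkmax⟩ := hK.exists_isGreatest hK'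
    obtain ⟨l, hl, hlmin⟩ := hL.exists_isLeast hL'
    have hKl : volume ((fun x => l + x) '' K) = volume K := by
      simp [image_add_left, measure_preimage_add]
    have hLk : volume ((fun x => k + x) '' L) = volume L := by
      simp [image_add_left, measure_preimage_add]
    have hmeas : MeasurableSet ((fun x => k + x) '' L) :=
      (hL.image (continuous_const_add k)).measurableSet
    -- With k = max K and l = min L, the translates l + K and k + L lie in C and meet at most at k +
    -- l.
    rw [← hKl, ← hLk, ← measure_union₀ hmeas.nullMeasurableSet]
    · refine measure_mono ?_
      rintro _ (⟨x, hx, rfl⟩ | ⟨x, hx, rfl⟩)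
      · simpa [add_comm] using hC x (hKA hx) l (hLB hl)
      · exact hC k (hKA hk) x (hLB hx)
    · refine measure_mono_null (t := {k + l}) ?_ (by simp)
      rintro _ ⟨⟨x, hx, rfl⟩, ⟨y, hy, hxy⟩⟩
      have h1 := hkmax hx
      have h2 := hlmin hy
      simp only [mem_singleton_iff] at *
      linarith
  obtain ⟨a, ha⟩ := hA'
  obtain ⟨b, hb⟩ := hB'
  rw [hA.measure_eq_iSup_isCompact, hB.measure_eq_iSup_isCompact]
  simp only [iSup_and']
  refine ENNReal.biSup_add_biSup_le' ⟨∅, empty_subset _, isCompact_empty⟩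
    ⟨∅, empty_subset _, isCompact_empty⟩ fun K hK L hL => ?_
  -- The approximating compacts may be empty; adjoining a and b makes them nonempty.
  exact (add_le_add (measure_mono (subset_insert a K)) (measure_mono (subset_insert b L))).trans
    (key _ (insert_subset ha hK.1) (hK.2.insert a) (insert_nonempty a K)
      _ (insert_subset hb hL.1) (hL.2.insert b) (insert_nonempty b L))

lemma lintegral_eq_lintegral_meas_ofReal_lt {α : Type*} [MeasurableSpace α] (μ : Measure α)
    {f : α → ℝ≥0∞} (hf : Measurable f) (hf' : ∀ x, f x ≠ ∞) :
    ∫⁻ x, f x ∂μ = ∫⁻ t in Ioi (0 : ℝ), μ {x | ENNReal.ofReal t < f x} := by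
  have h := lintegral_eq_lintegral_meas_lt μ (f := fun x => (f x).toReal)
    (Eventually.of_forall fun _ => ENNReal.toReal_nonneg) hf.ennreal_toReal.aemeasurable
  simp only [ENNReal.ofReal_toReal (hf' _)] at h
  rw [h]
  refine setLIntegral_congr_fun measurableSet_Ioi fun t ht => ?_
  simp only [ENNReal.ofReal_lt_iff_lt_toReal (le_of_lt ht) (hf' _)]

/-- Equal suprema make the superlevel sets of F and G nonempty for the same levels t < 1, so
Brunn–Minkowski applies at each level; the layer-cake formula integrates the result. -/
lemma lintegral_add_lintegral_le_of_min_le {F G H : ℝ → ℝ≥0∞} (hF : Measurable F)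
    (hG : Measurable G) (hH : Measurable H) (hF1 : ⨆ x, F x = 1) (hG1 : ⨆ x, G x = 1)
    (h : ∀ x y, min (F x) (G y) ≤ H (x + y)) :
    (∫⁻ x, F x) + ∫⁻ x, G x ≤ ∫⁻ x, H x := by
  have hFle : ∀ x, F x ≤ 1 := fun x => hF1 ▸ le_iSup F x
  have hGle : ∀ x, G x ≤ 1 := fun x => hG1 ▸ le_iSup G x
  have hne : ∀ {a : ℝ≥0∞}, a ≤ 1 → a ≠ ∞ := fun ha => ne_top_of_le_ne_top ENNReal.one_ne_top ha
  have hH1 : ∫⁻ x, min (H x) 1 ≤ ∫⁻ x, H x := lintegral_mono fun x => min_le_left _ _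
  refine le_trans ?_ hH1
  rw [lintegral_eq_lintegral_meas_ofReal_lt _ hF fun x => hne (hFle x),
    lintegral_eq_lintegral_meas_ofReal_lt _ hG fun x => hne (hGle x),
    lintegral_eq_lintegral_meas_ofReal_lt _ (hH.min measurable_const)
      fun x => hne (min_le_right _ _)]
  refine (le_lintegral_add _ _).trans (setLIntegral_mono' measurableSet_Ioi fun t _ => ?_)
  rcases lt_or_ge (ENNReal.ofReal t) 1 with ht | ht
  · refine Real.volume_add_volume_le_of_add_mem (measurableSet_lt measurable_const hF)
      (measurableSet_lt measurable_const hG) ?_ ?_ ?_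
    · rw [← hF1] at ht
      exact lt_iSup_iff.1 ht
    · rw [← hG1] at ht
      exact lt_iSup_iff.1 ht
    · intro a ha b hb
      exact lt_min ((lt_min ha hb).trans_le (h a b)) ht
  · have h1 : {x | ENNReal.ofReal t < F x} = ∅ :=
      eq_empty_of_forall_notMem fun x hx => (ht.trans_lt hx).not_ge (hFle x)
    have h2 : {x | ENNReal.ofReal t < G x} = ∅ :=
      eq_empty_of_forall_notMem fun x hx => (ht.trans_lt hx).not_ge (hGle x)
    simp [h1, h2]

/-- Hölder for two-term sums, with exponents 1 + s and (1 + s)/s. -/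
lemma ENNReal.rpow_mul_rpow_add_le {s : ℝ} (hs : 0 < s) (u v a b : ℝ≥0∞) :
    (u * a ^ s) ^ (1 / (1 + s)) + (v * b ^ s) ^ (1 / (1 + s))
      ≤ ((u + v) * (a + b) ^ s) ^ (1 / (1 + s)) := by
  have hpq : (1 + s).HolderConjugate ((1 + s) / s) := by
    rw [Real.holderConjugate_iff]
    refine ⟨by linarith, ?_⟩
    field_simp
  have h1 : 0 ≤ 1 / (1 + s) := by positivity
  have h := ENNReal.inner_le_Lp_mul_Lq Finset.univ ![u ^ (1 / (1 + s)), v ^ (1 / (1 + s))]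
    ![a ^ (s / (1 + s)), b ^ (s / (1 + s))] hpq
  have e1 : 1 / (1 + s) * (1 + s) = 1 := by field_simp
  have e2 : s / (1 + s) * ((1 + s) / s) = 1 := by field_simp
  have e3 : s * (1 / (1 + s)) = s / (1 + s) := by ring
  have e4 : 1 / ((1 + s) / s) = s / (1 + s) := by field_simp
  simp only [Fin.sum_univ_two, Matrix.cons_val_zero, Matrix.cons_val_one, ← ENNReal.rpow_mul,
    e1, e2, e4, ENNReal.rpow_one] at h
  simpa only [ENNReal.mul_rpow_of_nonneg _ _ h1, ← ENNReal.rpow_mul, e3] using h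

lemma lintegral_rpow_add_le_of_iSup_ne_top {s : ℝ} (hs : 0 < s) {F G H : ℝ → ℝ≥0∞}
    (hF : Measurable F) (hG : Measurable G) (hH : Measurable H)
    (hF0 : ⨆ x, F x ≠ 0) (hG0 : ⨆ x, G x ≠ 0) (hFt : ⨆ x, F x ≠ ∞) (hGt : ⨆ x, G x ≠ ∞)
    (h : ∀ x y, F x ≠ 0 → G y ≠ 0 → F x ^ (1 / s) + G y ^ (1 / s) ≤ H (x + y) ^ (1 / s)) :
    (∫⁻ x, F x) ^ (1 / (1 + s)) + (∫⁻ x, G x) ^ (1 / (1 + s)) ≤ (∫⁻ x, H x) ^ (1 / (1 + s)) := by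
  have hs' : 0 < 1 / s := by positivity
  set M := ⨆ x, F x
  set N := ⨆ x, G x
  set a := M ^ (1 / s) with ha
  set b := N ^ (1 / s) with hb
  have hat : a ≠ ∞ := ENNReal.rpow_ne_top_of_nonneg hs'.le hFt
  have hbt : b ≠ ∞ := ENNReal.rpow_ne_top_of_nonneg hs'.le hGt
  have ha0 : a ≠ 0 := by simp [ha, ENNReal.rpow_eq_zero_iff, hF0, hFt]
  have has : a ^ s = M := by rw [ha, ← ENNReal.rpow_mul, one_div_mul_cancel hs.ne', ENNReal.rpow_one]
  have hbs : b ^ s = N := by rw [hb, ← ENNReal.rpow_mul, one_div_mul_cancel hs.ne', ENNReal.rpow_one]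
  -- The scale for H: if F x ≥ mM and G y ≥ mN, then H(x + y)^{1/s} ≥ m^{1/s}(a + b), that is, H(x +
  -- y) ≥ mc.
  set c := (a + b) ^ s with hc
  have hc0 : c ≠ 0 := by simp [hc, ENNReal.rpow_eq_zero_iff, ha0, hat, hbt, hs.not_gt]
  have hct : c ≠ ∞ := ENNReal.rpow_ne_top_of_nonneg hs.le (by simp [hat, hbt])
  have key : (∫⁻ x, F x * M⁻¹) + ∫⁻ x, G x * N⁻¹ ≤ ∫⁻ x, H x * c⁻¹ := by
    refine lintegral_add_lintegral_le_of_min_le (hF.mul_const _) (hG.mul_const _)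
      (hH.mul_const _) ?_ ?_ ?_
    · rw [← ENNReal.iSup_mul, ENNReal.mul_inv_cancel hF0 hFt]
    · rw [← ENNReal.iSup_mul, ENNReal.mul_inv_cancel hG0 hGt]
    · intro x y
      set m := min (F x * M⁻¹) (G y * N⁻¹)
      rcases eq_or_ne m 0 with h0 | h0
      · simp [h0]
      have hx : m * M ≤ F x := by
        calc m * M ≤ F x * M⁻¹ * M := by gcongr; exact min_le_left _ _
          _ = F x := by rw [mul_assoc, ENNReal.inv_mul_cancel hF0 hFt, mul_one]
      have hy : m * N ≤ G y := by
        calc m * N ≤ G y * N⁻¹ * N := by gcongr; exact min_le_right _ _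
          _ = G y := by rw [mul_assoc, ENNReal.inv_mul_cancel hG0 hGt, mul_one]
      have hx0 : F x ≠ 0 := fun h' => by simp [h', hF0, h0] at hx
      have hy0 : G y ≠ 0 := fun h' => by simp [h', hG0, h0] at hy
      have h1 : (m * c) ^ (1 / s) ≤ H (x + y) ^ (1 / s) := by
        calc (m * c) ^ (1 / s) = m ^ (1 / s) * (a + b) := by
              rw [ENNReal.mul_rpow_of_nonneg _ _ hs'.le, hc, ← ENNReal.rpow_mul,
                mul_one_div_cancel hs.ne', ENNReal.rpow_one]
          _ = (m * M) ^ (1 / s) + (m * N) ^ (1 / s) := by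
              rw [ENNReal.mul_rpow_of_nonneg _ _ hs'.le, ENNReal.mul_rpow_of_nonneg _ _ hs'.le,
                mul_add]
          _ ≤ F x ^ (1 / s) + G y ^ (1 / s) := by gcongr
          _ ≤ _ := h x y hx0 hy0
      rw [ENNReal.rpow_le_rpow_iff hs'] at h1
      rw [← div_eq_mul_inv]
      exact (ENNReal.le_div_iff_mul_le (Or.inl hc0) (Or.inl hct)).2 h1
  rw [lintegral_mul_const _ hF, lintegral_mul_const _ hG, lintegral_mul_const _ hH,
    ← div_eq_mul_inv (∫⁻ x, H x), ENNReal.le_div_iff_mul_le (Or.inl hc0) (Or.inl hct)] at key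
  have hh := ENNReal.rpow_mul_rpow_add_le hs ((∫⁻ x, F x) * M⁻¹) ((∫⁻ x, G x) * N⁻¹) a b
  rw [has, hbs, mul_assoc, mul_assoc, ENNReal.inv_mul_cancel hF0 hFt,
    ENNReal.inv_mul_cancel hG0 hGt, mul_one, mul_one] at hh
  exact hh.trans (ENNReal.rpow_le_rpow key (by positivity))

/-- One-dimensional Borell–Brascamp–Lieb inequality, in superadditive form. -/
lemma lintegral_real_rpow_add_le {s : ℝ} (hs : 0 < s) {F G H : ℝ → ℝ≥0∞}
    (hF : Measurable F) (hG : Measurable G) (hH : Measurable H)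
    (hF0 : ∃ x, F x ≠ 0) (hG0 : ∃ x, G x ≠ 0)
    (h : ∀ x y, F x ≠ 0 → G y ≠ 0 → F x ^ (1 / s) + G y ^ (1 / s) ≤ H (x + y) ^ (1 / s)) :
    (∫⁻ x, F x) ^ (1 / (1 + s)) + (∫⁻ x, G x) ^ (1 / (1 + s)) ≤ (∫⁻ x, H x) ^ (1 / (1 + s)) := by
  have hlim : ∀ {F : ℝ → ℝ≥0∞}, Measurable F →
      Tendsto (fun k : ℕ => (∫⁻ x, min (F x) (k + 1)) ^ (1 / (1 + s))) atTop
        (𝓝 ((∫⁻ x, F x) ^ (1 / (1 + s)))) := by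
    intro F hF
    refine (ENNReal.continuous_rpow_const.tendsto _).comp ?_
    refine lintegral_tendsto_of_tendsto_of_monotone
      (fun k => (hF.min measurable_const).aemeasurable) ?_ ?_
    · refine Eventually.of_forall fun x i j hij => ?_
      dsimp only
      gcongr
    · refine Eventually.of_forall fun x => ?_
      have h1 : Tendsto (fun k : ℕ => ((k : ℝ≥0∞) + 1)) atTop (𝓝 ∞) := by
        simpa [Function.comp_def] using
          ENNReal.tendsto_nat_nhds_top.comp (tendsto_add_atTop_nat 1)
      simpa using (tendsto_const_nhds (x := F x)).min h1
  have hne : ∀ {F : ℝ → ℝ≥0∞} (k : ℕ), (∃ x, F x ≠ 0) → ⨆ x, min (F x) ((k : ℝ≥0∞) + 1) ≠ 0 := by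
    rintro F k ⟨x, hx⟩ h0
    simp only [ENNReal.iSup_eq_zero] at h0
    have := h0 x
    rcases min_choice (F x) ((k : ℝ≥0∞) + 1) with h' | h' <;> rw [h'] at this
    · exact hx this
    · simp at this
  have hnt : ∀ {F : ℝ → ℝ≥0∞} (k : ℕ), ⨆ x, min (F x) ((k : ℝ≥0∞) + 1) ≠ ∞ := by
    intro F k
    exact ne_top_of_le_ne_top (b := (k : ℝ≥0∞) + 1) (by simp) (iSup_le fun x => min_le_right _ _)
  -- Truncation makes the suprema finite; the height k + 1 keeps them nonzero even at k = 0.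
  refine le_of_tendsto' ((hlim hF).add (hlim hG)) fun k => ?_
  refine lintegral_rpow_add_le_of_iSup_ne_top hs (hF.min measurable_const)
    (hG.min measurable_const) hH (hne k hF0) (hne k hG0) (hnt k) (hnt k) fun x y hx hy => ?_
  refine le_trans ?_ (h x y (fun h' => hx (by simp [h'])) (fun h' => hy (by simp [h'])))
  gcongr <;> exact min_le_left _ _

/-! ### Higher dimensions -/

/-- By the induction hypothesis on slices, the marginals satisfy the one-dimensional condition with
s replaced by n + s. -/
lemma lintegral_pi_rpow_add_le (n : ℕ) {s : ℝ} (hs : 0 < s) {f g h : (Fin n → ℝ) → ℝ≥0∞}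
    (hf : Measurable f) (hg : Measurable g) (hh : Measurable h)
    (hf0 : ∫⁻ x, f x ≠ 0) (hg0 : ∫⁻ x, g x ≠ 0)
    (hfgh : ∀ x y, f x ≠ 0 → g y ≠ 0 → f x ^ (1 / s) + g y ^ (1 / s) ≤ h (x + y) ^ (1 / s)) :
    (∫⁻ x, f x) ^ (1 / (n + s)) + (∫⁻ x, g x) ^ (1 / (n + s))
      ≤ (∫⁻ x, h x) ^ (1 / (n + s)) := by
  induction n with
  | zero =>
    have hd : ∀ f : (Fin 0 → ℝ) → ℝ≥0∞, ∫⁻ x, f x = f 0 := by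
      intro f
      rw [volume_pi, Measure.pi_of_empty _ 0, lintegral_dirac]
    simp only [hd, Nat.cast_zero, zero_add] at *
    simpa using hfgh 0 0 hf0 hg0
  | succ n ih =>
    let e := MeasurableEquiv.piFinSuccAbove (fun _ : Fin (n + 1) => ℝ) 0
    have he : MeasurePreserving e.symm :=
      (volume_preserving_piFinSuccAbove (fun _ : Fin (n + 1) => ℝ) 0).symm _
    have hadd : ∀ a b x y, e.symm (a + b, x + y) = e.symm (a, x) + e.symm (b, y) := by
      intro a b x y
      ext i
      refine Fin.cases ?_ (fun j => ?_) i <;> simp [e]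
    have hint : ∀ {f : (Fin (n + 1) → ℝ) → ℝ≥0∞}, Measurable f →
        ∫⁻ x, f x = ∫⁻ a, ∫⁻ x, f (e.symm (a, x)) := by
      intro f hf
      rw [← he.lintegral_comp hf]
      exact lintegral_prod _ (hf.comp e.symm.measurable).aemeasurable
    have hslice : ∀ {f : (Fin (n + 1) → ℝ) → ℝ≥0∞}, Measurable f → ∀ a,
        Measurable fun x => f (e.symm (a, x)) := fun hf a =>
      hf.comp (e.symm.measurable.comp measurable_prodMk_left)
    have hmarg : ∀ {f : (Fin (n + 1) → ℝ) → ℝ≥0∞}, Measurable f →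
        Measurable fun a => ∫⁻ x, f (e.symm (a, x)) := fun hf =>
      (hf.comp e.symm.measurable).lintegral_prod_right'
    have hne : ∀ {f : (Fin (n + 1) → ℝ) → ℝ≥0∞}, Measurable f → ∫⁻ x, f x ≠ 0 →
        ∃ a, ∫⁻ x, f (e.symm (a, x)) ≠ 0 := by
      intro f hf hf0
      by_contra! hz
      simp [hint hf, hz] at hf0
    have h1 := lintegral_real_rpow_add_le (s := n + s) (by positivity) (hmarg hf) (hmarg hg)
      (hmarg hh) (hne hf hf0) (hne hg hg0) fun a b ha hb =>
        ih (hslice hf a) (hslice hg b) (hslice hh (a + b)) ha hb fun x y hx hy => by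
          rw [hadd]
          exact hfgh _ _ hx hy
    rw [← hint hf, ← hint hg, ← hint hh] at h1
    have e1 : 1 + (n + s) = ((n + 1 : ℕ) : ℝ) + s := by push_cast; ring
    rwa [e1] at h1

/-- The majorant must dominate everywhere, not just almost everywhere, so that a pointwise condition
on h survives the replacement. -/
lemma AEMeasurable.exists_measurable_ge {α : Type*} [MeasurableSpace α] {μ : Measure α}
    {f : α → ℝ≥0∞} (hf : AEMeasurable f μ) : ∃ g, Measurable g ∧ f ≤ g ∧ g =ᵐ[μ] f := by
  classical
  let N := toMeasurable μ {x | f x ≠ hf.mk f x}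
  have hN : μ N = 0 := by
    rw [measure_toMeasurable]
    exact hf.ae_eq_mk
  have hmem : ∀ x, x ∉ N → f x = hf.mk f x := fun x hx => by
    by_contra hne
    exact hx (subset_toMeasurable _ _ hne)
  refine ⟨N.piecewise (fun _ => ∞) (hf.mk f),
    Measurable.piecewise (measurableSet_toMeasurable _ _) measurable_const hf.measurable_mk,
    fun x => ?_, ?_⟩
  · by_cases hx : x ∈ N
    · simp [hx]
    · simp [hx, hmem x hx]
  · filter_upwards [measure_eq_zero_iff_ae_notMem.1 hN] with x hx
    simp [hx, hmem x hx]

/-- Borell–Brascamp–Lieb inequality, in superadditive form. -/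
lemma integral_rpow_add_le (n : ℕ) {s : ℝ} (hs : 0 < s) {f g h : EuclideanSpace ℝ (Fin n) → ℝ}
    (hf_nonneg : ∀ x, 0 ≤ f x) (hg_nonneg : ∀ x, 0 ≤ g x) (hh_nonneg : ∀ x, 0 ≤ h x)
    (hf_int : Integrable f volume) (hg_int : Integrable g volume) (hh_int : Integrable h volume)
    (hf0 : ∃ x, f x ≠ 0) (hg0 : ∃ x, g x ≠ 0)
    (hfgh : ∀ x y, f x ≠ 0 → g y ≠ 0 → f x ^ (1 / s) + g y ^ (1 / s) ≤ h (x + y) ^ (1 / s)) :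
    (∫ x, f x) ^ (1 / (n + s)) + (∫ x, g x) ^ (1 / (n + s))
      ≤ (∫ x, h x) ^ (1 / (n + s)) := by
  have hs' : 0 < 1 / s := by positivity
  have hns : 0 < 1 / (n + s) := by positivity
  -- Settles the case of a zero integral: fixing x with f x ≠ 0 gives g ≤ h(x + ·).
  have hdeg : ∀ {f g : EuclideanSpace ℝ (Fin n) → ℝ}, (∀ x, 0 ≤ f x) → (∀ x, 0 ≤ g x) →
      Integrable g volume → (∃ x, f x ≠ 0) →
      (∀ x y, f x ≠ 0 → g y ≠ 0 → f x ^ (1 / s) + g y ^ (1 / s) ≤ h (x + y) ^ (1 / s)) →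
      ∫ x, g x ≤ ∫ x, h x := by
    rintro f g hf hg hgi ⟨x, hx⟩ hfg
    rw [← integral_add_left_eq_self h x]
    refine integral_mono hgi (hh_int.comp_add_left x) fun y => ?_
    by_cases hy : g y = 0
    · simpa [hy] using hh_nonneg _
    · rw [← Real.rpow_le_rpow_iff (hg y) (hh_nonneg _) hs']
      have := hfg x y hx hy
      have := Real.rpow_nonneg (hf x) (1 / s)
      linarith
  have hF : 0 ≤ ∫ x, f x := integral_nonneg hf_nonneg
  have hG : 0 ≤ ∫ x, g x := integral_nonneg hg_nonneg
  have hH : 0 ≤ ∫ x, h x := integral_nonneg hh_nonneg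
  rcases hF.eq_or_lt' with hf1 | hf1
  · rw [hf1, Real.zero_rpow hns.ne', zero_add]
    exact Real.rpow_le_rpow hG
      (hdeg hf_nonneg hg_nonneg hg_int hf0 hfgh) hns.le
  rcases hG.eq_or_lt' with hg1 | hg1
  · rw [hg1, Real.zero_rpow hns.ne', add_zero]
    refine Real.rpow_le_rpow hF
      (hdeg hg_nonneg hf_nonneg hf_int hg0 fun x y hx hy => ?_) hns.le
    rw [add_comm, add_comm x]
    exact hfgh y x hy hx
  have hof : ∀ {f : EuclideanSpace ℝ (Fin n) → ℝ}, (∀ x, 0 ≤ f x) → Integrable f volume →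
      ENNReal.ofReal (∫ x, f x) = ∫⁻ x, ENNReal.ofReal (f x) := fun hf hfi =>
    ofReal_integral_eq_lintegral_ofReal hfi (Eventually.of_forall hf)
  obtain ⟨f', hf'm, hf'le, hf'⟩ :=
    exists_measurable_le_lintegral_eq volume fun x => ENNReal.ofReal (f x)
  obtain ⟨g', hg'm, hg'le, hg'⟩ :=
    exists_measurable_le_lintegral_eq volume fun x => ENNReal.ofReal (g x)
  obtain ⟨h', hh'm, hh'le, hh'⟩ := hh_int.aemeasurable.ennreal_ofReal.exists_measurable_ge
  have hL := PiLp.volume_preserving_toLp (Fin n)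
  have hmL := hL.measurable
  have key := lintegral_pi_rpow_add_le n hs (hf'm.comp hmL) (hg'm.comp hmL) (hh'm.comp hmL)
  simp only [Function.comp_apply, hL.lintegral_comp hf'm, hL.lintegral_comp hg'm,
    hL.lintegral_comp hh'm, lintegral_congr_ae hh', ← hf', ← hg', ← hof hf_nonneg hf_int,
    ← hof hg_nonneg hg_int, ← hof hh_nonneg hh_int] at key
  have key' := key (by simpa using hf1) (by simpa using hg1) ?_
  · rw [ENNReal.ofReal_rpow_of_nonneg hF hns.le,
      ENNReal.ofReal_rpow_of_nonneg hG hns.le,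
      ENNReal.ofReal_rpow_of_nonneg hH hns.le,
      ← ENNReal.ofReal_add (by positivity) (by positivity)] at key'
    exact (ENNReal.ofReal_le_ofReal_iff
      (Real.rpow_nonneg hH _)).1 key'
  · intro x y hx hy
    set x' := WithLp.toLp 2 x
    set y' := WithLp.toLp 2 y
    have hxy : WithLp.toLp 2 (x + y) = x' + y' := rfl
    have hx0 : f x' ≠ 0 := fun h0 => hx (le_antisymm ((hf'le x').trans (by simp [h0])) zero_le)
    have hy0 : g y' ≠ 0 := fun h0 => hy (le_antisymm ((hg'le y').trans (by simp [h0])) zero_le)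
    rw [hxy]
    calc f' x' ^ (1 / s) + g' y' ^ (1 / s)
        ≤ ENNReal.ofReal (f x') ^ (1 / s) + ENNReal.ofReal (g y') ^ (1 / s) := by
          gcongr
          · exact hf'le x'
          · exact hg'le y'
      _ = ENNReal.ofReal (f x' ^ (1 / s) + g y' ^ (1 / s)) := by
          rw [ENNReal.ofReal_rpow_of_nonneg (hf_nonneg _) hs'.le,
            ENNReal.ofReal_rpow_of_nonneg (hg_nonneg _) hs'.le,
            ENNReal.ofReal_add (Real.rpow_nonneg (hf_nonneg _) _)
              (Real.rpow_nonneg (hg_nonneg _) _)]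
      _ ≤ ENNReal.ofReal (h (x' + y') ^ (1 / s)) := ENNReal.ofReal_le_ofReal (hfgh _ _ hx0 hy0)
      _ = ENNReal.ofReal (h (x' + y')) ^ (1 / s) :=
          (ENNReal.ofReal_rpow_of_nonneg (hh_nonneg _) hs'.le).symm
      _ ≤ h' (x' + y') ^ (1 / s) := by
          gcongr
          exact hh'le _

/-! ### Weights and optimisation over λ -/

/-- Replacing f by α^s f(·/α) multiplies f^{1/s} by α and the integral by α^{n+s}; likewise for g
with β. -/
lemma integral_rpow_smul_add_smul_le (n : ℕ) {s α β : ℝ} (hs : 0 < s) (hα : 0 < α) (hβ : 0 < β)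
    {f g h : EuclideanSpace ℝ (Fin n) → ℝ}
    (hf_nonneg : ∀ x, 0 ≤ f x) (hg_nonneg : ∀ x, 0 ≤ g x) (hh_nonneg : ∀ x, 0 ≤ h x)
    (hf_int : Integrable f volume) (hg_int : Integrable g volume) (hh_int : Integrable h volume)
    (hf0 : ∃ x, f x ≠ 0) (hg0 : ∃ x, g x ≠ 0)
    (hfgh : ∀ x y, f x ≠ 0 → g y ≠ 0 →
      α * f x ^ (1 / s) + β * g y ^ (1 / s) ≤ h (α • x + β • y) ^ (1 / s)) :
    α * (∫ x, f x) ^ (1 / (n + s)) + β * (∫ x, g x) ^ (1 / (n + s))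
      ≤ (∫ x, h x) ^ (1 / (n + s)) := by
  have hns : (0 : ℝ) < n + s := by positivity
  have hint : ∀ {α : ℝ} {f : EuclideanSpace ℝ (Fin n) → ℝ}, 0 < α → (∀ x, 0 ≤ f x) →
      (∫ x, α ^ s * f (α⁻¹ • x)) ^ (1 / (n + s)) = α * (∫ x, f x) ^ (1 / (n + s)) := by
    intro α f hα hf
    rw [integral_const_mul, Measure.integral_comp_inv_smul_of_nonneg _ _ hα.le,
      finrank_euclideanSpace_fin, smul_eq_mul, ← mul_assoc, ← Real.rpow_natCast α n,
      ← Real.rpow_add hα, Real.mul_rpow (by positivity) (integral_nonneg hf), ← Real.rpow_mul hα.le,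
      add_comm s, mul_one_div_cancel hns.ne', Real.rpow_one]
  have hpow : ∀ {α u : ℝ}, 0 < α → 0 ≤ u → (α ^ s * u) ^ (1 / s) = α * u ^ (1 / s) := by
    intro α u hα hu
    rw [Real.mul_rpow (by positivity) hu, ← Real.rpow_mul hα.le, mul_one_div_cancel hs.ne',
      Real.rpow_one]
  have hex : ∀ {α : ℝ} {f : EuclideanSpace ℝ (Fin n) → ℝ}, 0 < α → (∃ x, f x ≠ 0) →
      ∃ x, α ^ s * f (α⁻¹ • x) ≠ 0 := by
    rintro α f hα ⟨x, hx⟩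
    refine ⟨α • x, mul_ne_zero (by positivity) ?_⟩
    rwa [inv_smul_smul₀ hα.ne']
  rw [← hint hα hf_nonneg, ← hint hβ hg_nonneg]
  refine integral_rpow_add_le n hs (fun x => mul_nonneg (by positivity) (hf_nonneg _))
    (fun x => mul_nonneg (by positivity) (hg_nonneg _)) hh_nonneg
    ((hf_int.comp_smul (inv_ne_zero hα.ne')).const_mul _)
    ((hg_int.comp_smul (inv_ne_zero hβ.ne')).const_mul _) hh_int (hex hα hf0) (hex hβ hg0) ?_
  intro x y hx hy
  rw [hpow hα (hf_nonneg _), hpow hβ (hg_nonneg _)]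
  have := hfgh (α⁻¹ • x) (β⁻¹ • y) (right_ne_zero_of_mul hx) (right_ne_zero_of_mul hy)
  rwa [smul_inv_smul₀ hα.ne', smul_inv_smul₀ hβ.ne'] at this

lemma rpow_add_rpow_le_of_forall_mem_Ioo {p A B C : ℝ} (hp : 1 ≤ p) (hA : 0 ≤ A) (hB : 0 ≤ B)
    (h : ∀ t ∈ Ioo (0 : ℝ) 1, (1 - t) ^ (1 - 1 / p) * A + t ^ (1 - 1 / p) * B ≤ C) :
    A ^ p + B ^ p ≤ C ^ p := by
  have hp0 : 0 < p := by linarith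
  have hr : 0 ≤ 1 - 1 / p := by
    rw [sub_nonneg, div_le_one hp0]
    exact hp
  -- The optimal t is an endpoint when A or B vanishes, so the bound is extended by continuity.
  have hcont : ∀ t ∈ Icc (0 : ℝ) 1, (1 - t) ^ (1 - 1 / p) * A + t ^ (1 - 1 / p) * B ≤ C := by
    rw [← closure_Ioo zero_ne_one]
    refine fun t ht => closure_minimal (t := {t : ℝ | _ ≤ C}) h
      (isClosed_le ?_ continuous_const) ht
    exact (((continuous_const.sub continuous_id).rpow_const fun _ => Or.inr hr).mul_const _).add
      ((continuous_id.rpow_const fun _ => Or.inr hr).mul_const _)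
  have hC : 0 ≤ C := le_trans (by positivity) (hcont (1 / 2) (by norm_num))
  set S := A ^ p + B ^ p with hS
  have hAp : 0 ≤ A ^ p := by positivity
  have hBp : 0 ≤ B ^ p := by positivity
  rcases (add_nonneg hAp hBp).eq_or_lt' with h0 | hpos
  · rw [hS, h0]
    positivity
  -- This t maximises the left side, where it equals S^{1/p}.
  have h1 := hcont (B ^ p / S) ⟨by positivity, (div_le_one hpos).2 (by linarith)⟩
  have e1 : 1 - B ^ p / S = A ^ p / S := by
    rw [eq_div_iff hpos.ne', sub_mul, div_mul_cancel₀ _ hpos.ne']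
    linarith
  have hcoord : ∀ {a : ℝ}, 0 ≤ a → (a ^ p / S) ^ (1 - 1 / p) * a = a ^ p / S ^ (1 - 1 / p) := by
    intro a ha
    rcases ha.eq_or_lt with rfl | ha'
    · simp [Real.zero_rpow hp0.ne']
    rw [Real.div_rpow (by positivity) hpos.le, ← Real.rpow_mul ha, div_mul_eq_mul_div]
    congr 1
    nth_rewrite 2 [← Real.rpow_one a]
    rw [← Real.rpow_add ha']
    congr 1
    field_simp
    ring
  rw [e1, hcoord hA, hcoord hB, ← add_div, ← hS] at h1
  have e2 : S / S ^ (1 - 1 / p) = S ^ (1 / p) := by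
    nth_rewrite 1 [← Real.rpow_one S]
    rw [← Real.rpow_sub hpos]
    congr 1
    ring
  rw [e2] at h1
  calc S = (S ^ (1 / p)) ^ p := by
        rw [← Real.rpow_mul hpos.le, one_div_mul_cancel hp0.ne', Real.rpow_one]
    _ ≤ C ^ p := Real.rpow_le_rpow (by positivity) h1 hp0.le

theorem theorem1p5 (n : ℕ) (p : ℝ) (hp : 1 ≤ p)
    (q : ℝ≥0∞) (hpq : ENNReal.HolderConjugate (ENNReal.ofReal p) q)
    (s μ ω : ℝ) (hs : 0 < s) (hμ : 0 < μ) (hω : 0 < ω)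
    (f g h : EuclideanSpace ℝ (Fin n) → ℝ)
    (hf_nonneg : ∀ x, 0 ≤ f x) (hg_nonneg : ∀ x, 0 ≤ g x) (hh_nonneg : ∀ x, 0 ≤ h x)
    (hf_int : Integrable f volume) (hg_int : Integrable g volume) (hh_int : Integrable h volume)
    (hf_supp : (tsupport f).Nonempty) (hg_supp : (tsupport g).Nonempty)
    (hh_supp : (tsupport h).Nonempty)
    (hfgh : ∀ x ∈ tsupport f, ∀ y ∈ tsupport g, ∀ t ∈ Set.Icc (0 : ℝ) 1,
      (1 - t) ^ (q⁻¹).toReal * μ ^ (1 / p) * f x ^ (1 / s)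
          + t ^ (q⁻¹).toReal * ω ^ (1 / p) * g y ^ (1 / s)
        ≤ h (((1 - t) ^ (q⁻¹).toReal * μ ^ (1 / p)) • x
            + (t ^ (q⁻¹).toReal * ω ^ (1 / p)) • y) ^ (1 / s)) :
    μ * (∫ x, f x) ^ (p / ((n : ℝ) + s)) + ω * (∫ x, g x) ^ (p / ((n : ℝ) + s))
      ≤ (∫ x, h x) ^ (p / ((n : ℝ) + s)) := by
  have hp0 : 0 < p := by linarith
  have hq : (q⁻¹).toReal = 1 - 1 / p := by
    have h1 := hpq.inv_add_inv_eq_one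
    rw [← ENNReal.ofReal_inv_of_pos hp0] at h1
    have hqt : q⁻¹ ≠ ∞ := fun h' => by simp [h'] at h1
    have h2 := congrArg ENNReal.toReal h1
    rw [ENNReal.toReal_add ENNReal.ofReal_ne_top hqt, ENNReal.toReal_ofReal (by positivity)] at h2
    simp only [ENNReal.toReal_one] at h2
    rw [one_div]
    linarith
  rw [hq] at hfgh
  have hex : ∀ {f : EuclideanSpace ℝ (Fin n) → ℝ}, (tsupport f).Nonempty → ∃ x, f x ≠ 0 :=
    fun hf => closure_nonempty_iff.1 hf
  have hpow : ∀ {m I : ℝ}, 0 < m → 0 ≤ I →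
      (m ^ (1 / p) * I ^ (1 / ((n : ℝ) + s))) ^ p = m * I ^ (p / ((n : ℝ) + s)) := by
    intro m I hm hI
    rw [Real.mul_rpow (by positivity) (by positivity), ← Real.rpow_mul hm.le, ← Real.rpow_mul hI,
      one_div_mul_cancel hp0.ne', Real.rpow_one, one_div_mul_eq_div]
  have hF : 0 ≤ ∫ x, f x := integral_nonneg hf_nonneg
  have hG : 0 ≤ ∫ x, g x := integral_nonneg hg_nonneg
  have hH : 0 ≤ ∫ x, h x := integral_nonneg hh_nonneg
  have key := rpow_add_rpow_le_of_forall_mem_Ioo hp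
    (A := μ ^ (1 / p) * (∫ x, f x) ^ (1 / ((n : ℝ) + s)))
    (B := ω ^ (1 / p) * (∫ x, g x) ^ (1 / ((n : ℝ) + s)))
    (C := (∫ x, h x) ^ (1 / ((n : ℝ) + s))) (by positivity) (by positivity) fun t ht => by
      have ht1 : 0 < 1 - t := sub_pos.2 ht.2
      have ht0 : 0 < t := ht.1
      rw [← mul_assoc, ← mul_assoc]
      exact integral_rpow_smul_add_smul_le n hs (by positivity) (by positivity) hf_nonneg
        hg_nonneg hh_nonneg hf_int hg_int hh_int (hex hf_supp) (hex hg_supp) fun x y hx hy =>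
          hfgh x (subset_tsupport f hx) y (subset_tsupport g hy) t (Set.Ioo_subset_Icc_self ht)
  rwa [hpow hμ hF, hpow hω hG, ← Real.rpow_mul hH, one_div_mul_eq_div] at key
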